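/- Let $\varphi$ be any acceptable programming system for the partial computable functions $\mathbb{N}\rightharpoonup\mathbb{N}$ (that is, $(e,x)\mapsto\varphi_e(x)$ is partial computable, and for every partial computable $\psi(e,x)$ there is a total computable $t$ with $\varphi_{t(e)}=\psi(e,\cdot)$ for all $e$), and let $W_e=\mathrm{dom}(\varphi_e)$. A language is a computably enumerable set $L\subseteq\mathbb{N}$. A text is a function $T:\mathbb{N}\to\mathbb{N}\cup\{\#\}$; its content is $\mathrm{content}(T)=\mathrm{range}(T)\setminus\{\#\}$, and $T$ is a text for $L$ if $\mathrm{content}(T)=L$. Write $T[i]$ for the finite sequence $T(0),\dots,T(i-1)$, with content defined likewise. A learner is a partial computable function $h$ from finite sequences over $\mathbb{N}\cup\{\#\}$ to $\mathbb{N}$; its learning sequence on $T$ is $p(i)=h(T[i])$. For a total sequence $p:\mathbb{N}\to\mathbb{N}$ and a text $T$ define (with $\subset$ denoting proper inclusion) \begin{align*} \mathbf{Ex}(p,T)&\iff \exists n_0\,\forall n\ge n_0:\ p(n)=p(n_0)\ \text{and}\ W_{p(n_0)}=\mathrm{content}(T);\\ \mathbf{Conv}(p,T)&\iff \forall i:\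 \mathrm{content}(T[i+1])\subseteq W_{p(i)}\Rightarrow p(i)=p(i+1);\\ \mathbf{Caut}(p,T)&\iff \forall i,j:\ W_{p(i)}\subset W_{p(j)}\Rightarrow i<j;\\ \mathbf{Caut}_{\mathbf{Tar}}(p,T)&\iff \forall i:\ \neg(\mathrm{content}(T)\subset W_{p(i)});\\ \mathbf{Caut}_{\mathbf{Fin}}(p,T)&\iff \forall i<j:\ W_{p(j)}\subset W_{p(i)}\Rightarrow W_{p(j)}\text{ is infinite}. \end{align*} For each such restriction $\delta$, let $[\mathbf{TxtG}\delta\mathbf{Ex}]$ be the set of all classes $\mathcal{L}$ of languages for which there is a single learner $h$ such that, for every $L\in\mathcal{L}$ and every text $T$ for $L$, the learning sequence $p$ of $h$ on $T$ is total and satisfies both $\delta(p,T)$ and $\mathbf{Ex}(p,T)$. Theorem. For every $\delta\in\{\mathbf{Caut},\mathbf{Caut}_{\mathbf{Tar}},\mathbf{Caut}_{\mathbf{Fin}}\}$, $$[\mathbf{TxtG}\delta\mathbf{Ex}]=[\mathbf{TxtGConvEx}].$$ -/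

import Mathlib

namespace LimitLearning

/-- An acceptable programming system `φ` for the partial computable functions `ℕ ⇀ ℕ`: the
universal function `(e, x) ↦ φ e x` is partial computable, and every other programming system `ψ`
with partial computable universal function can be computably translated into `φ`.
(In particular every partial computable function has a `φ`-program.) -/
def IsAcceptable (φ : ℕ → ℕ →. ℕ) : Prop :=
  Partrec₂ φ ∧
    ∀ ψ : ℕ → ℕ →. ℕ, Partrec₂ ψ → ∃ t : ℕ → ℕ, Computable t ∧ ∀ e, φ (t e) = ψ e

/-- `W φ e` is the domain of the partial function computed by program `e`. -/
def W (φ : ℕ → ℕ →. ℕ) (e : ℕ) : Set ℕ := (φ e).Dom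

/-- A language is a computably enumerable set of natural numbers. -/
def IsLanguage (L : Set ℕ) : Prop := REPred fun x => x ∈ L

/-- A text is a total function into the natural numbers together with the pause symbol,
which is represented by `none`. -/
abbrev Text : Type := ℕ → Option ℕ

/-- Finite sequences of data (numbers and pauses). -/
abbrev DataSeq : Type := List (Option ℕ)

/-- The content of a finite sequence: its elements other than the pause symbol. -/
def DataSeq.content (σ : DataSeq) : Set ℕ := {x | some x ∈ σ}

/-- The content of a text: its values other than the pause symbol. -/
def Text.content (T : Text) : Set ℕ := {x | ∃ n, T n = some x}

/-- The initial sequence `T 0, …, T (n - 1)` of a text. -/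
def Text.init (T : Text) (n : ℕ) : DataSeq := (List.range n).map T

/-- The interaction operator of full-information (Gold-style) learning: the `i`-th hypothesis
of the (partial) learner `h` on the text `T` is `h` applied to the first `i` data. -/
def G (h : DataSeq →. ℕ) (T : Text) : ℕ →. ℕ := fun i => h (T.init i)

/-- A learning restriction is a predicate on a learning sequence and a text. All restrictions
require the learning sequence to be total; this is built in by taking total sequences here and
by asking for totality of the sequence produced by the learner in `Learns`.
Restrictions are combined by intersecting them, written `δ ⊓ δ'`. -/
abbrev LearningRestriction : Type := (ℕ → ℕ) → Text → Prop

/-- Explanatory learning: convergence to a single correct hypothesis. -/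
def Ex (φ : ℕ → ℕ →. ℕ) : LearningRestriction := fun p T =>
  ∃ n₀, ∀ n ≥ n₀, p n = p n₀ ∧ W φ (p n₀) = T.content

/-- Conservative: a hypothesis consistent with the data (including the next datum) is kept. -/
def Conv (φ : ℕ → ℕ →. ℕ) : LearningRestriction := fun p T =>
  ∀ i, (T.init (i + 1)).content ⊆ W φ (p i) → p i = p (i + 1)

/-- Cautious: no hypothesis for a proper subset of a previously conjectured set. -/
def Caut (φ : ℕ → ℕ →. ℕ) : LearningRestriction := fun p _ =>
  ∀ i j, W φ (p i) ⊂ W φ (p j) → i < j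

/-- No hypothesis for a finite proper subset of a previously conjectured set. -/
def CautFin (φ : ℕ → ℕ →. ℕ) : LearningRestriction := fun p _ =>
  ∀ i j, i < j → W φ (p j) ⊂ W φ (p i) → (W φ (p j)).Infinite

/-- No hypothesis for a proper superset of the target language. -/
def CautTar (φ : ℕ → ℕ →. ℕ) : LearningRestriction := fun p T =>
  ∀ i, ¬ T.content ⊂ W φ (p i)

/-- The learner `h` learns the language `L` from texts, with full information, subject to the
restriction `δ`: on every text for `L` the learning sequence is total and satisfies `δ`. -/
def Learns (δ : LearningRestriction) (h : DataSeq →. ℕ) (L : Set ℕ) : Prop :=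
  ∀ T : Text, T.content = L → ∃ p : ℕ → ℕ, (∀ i, p i ∈ G h T i) ∧ δ p T

/-- The set of all classes of languages for which a single partial computable learner learns
every member of the class subject to the restriction `δ`. -/
def TxtG (δ : LearningRestriction) : Set (Set (Set ℕ)) :=
  {𝓛 | (∀ L ∈ 𝓛, IsLanguage L) ∧ ∃ h : DataSeq →. ℕ, Partrec h ∧ ∀ L ∈ 𝓛, Learns δ h L}

end LimitLearning

namespace LimitLearning

/-! All three kinds of caution, combined with explanatory learning, share one consequence: no
conjecture made on a text for a finite target properly contains it (`cautTar_of_caut`,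
`not_ssubset_of_cautFin`). This alone makes a conservative learner possible
(`exists_conservative_learner`).

Pass to a total learner `h` and poison its conjectures: for a finite sequence `σ`, enumerate `W φ (h
σ)`, but stop for good once data from this set are found on which `h` changes its mind after `σ`.
The new learner keeps `σ` until the data provably leave the poisoned set `stablePart d h σ`, hence
is conservative (`not_refuted`). Every poisoned set missing part of the target is eventually refuted
(`eventually_refuted`), and locking sequences are never stopped, so the search converges to a set
containing the target (`candidate_converges`). It is not a proper superset
(`not_ssubset_stablePart`): a stopped enumeration is finite, so only finite targets are at risk, and
these are protected by the hypothesis; an unstopped one forces `h` to keep `h σ` on the target, so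
`W φ (h σ)` is the target.

Conversely, a conservative learner can never leave a proper superset of the target. For full caution
its conjectures are delayed until they are seen to contain their own data
(`exists_consistent_learner`, `mem_txtG_caut_of_conv`). -/

theorem Text.length_init (T : Text) (n : ℕ) : (T.init n).length = n := by
  simp [Text.init]

theorem Text.take_init (T : Text) {k n : ℕ} (h : k ≤ n) : (T.init n).take k = T.init k := by
  simp [Text.init, ← List.map_take, List.take_range, h]

theorem Text.mem_content_init {T : Text} {n x : ℕ} :
    x ∈ (T.init n).content ↔ ∃ m < n, T m = some x := by
  simp [Text.init, DataSeq.content]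

theorem Text.content_init_subset (T : Text) (n : ℕ) : (T.init n).content ⊆ T.content := by
  intro x hx
  obtain ⟨m, -, hm⟩ := Text.mem_content_init.1 hx
  exact ⟨m, hm⟩

theorem Text.content_init_mono (T : Text) {m n : ℕ} (h : m ≤ n) :
    (T.init m).content ⊆ (T.init n).content := by
  intro x hx
  obtain ⟨k, hk, e⟩ := Text.mem_content_init.1 hx
  exact Text.mem_content_init.2 ⟨k, hk.trans_le h, e⟩

theorem DataSeq.content_finite (σ : DataSeq) : σ.content.Finite := by
  refine ((σ.filterMap id).toFinset.finite_toSet).subset fun x hx => ?_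
  simpa [DataSeq.content] using hx

theorem DataSeq.content_append (σ τ : DataSeq) :
    DataSeq.content (σ ++ τ) = σ.content ∪ τ.content := by
  ext x
  simp [DataSeq.content]

theorem Text.exists_content_init_superset (T : Text) {F : Set ℕ} (hF : F.Finite)
    (h : F ⊆ T.content) : ∃ n, F ⊆ (T.init n).content := by
  induction F, hF using Set.Finite.induction_on with
  | empty => exact ⟨0, Set.empty_subset _⟩
  | @insert a s _ _ ih =>
    obtain ⟨n, hn⟩ := ih ((Set.subset_insert _ _).trans h)
    obtain ⟨m, hm⟩ := h (Set.mem_insert _ _)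
    refine ⟨max n (m + 1), Set.insert_subset ?_ (hn.trans (T.content_init_mono (le_max_left _ _)))⟩
    exact Text.mem_content_init.2 ⟨m, by omega, hm⟩

theorem exists_text (L : Set ℕ) : ∃ T : Text, T.content = L := by
  classical
  refine ⟨fun n => if n ∈ L then some n else none, ?_⟩
  ext x
  simp only [Text.content, Set.mem_ofPred_eq]
  constructor
  · rintro ⟨n, hn⟩
    split_ifs at hn with h
    cases hn
    exact h
  · intro h
    exact ⟨x, by simp [h]⟩

/-- The text `T` preceded by the finite sequence `σ`. -/
def Text.prepend (σ : DataSeq) (T : Text) : Text := fun n =>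
  if h : n < σ.length then σ[n] else T (n - σ.length)

theorem Text.prepend_init_add (σ : DataSeq) (T : Text) (n : ℕ) :
    (Text.prepend σ T).init (σ.length + n) = σ ++ T.init n := by
  apply List.ext_getElem
  · simp [Text.init]
  · intro i h₁ h₂
    simp [Text.init, Text.prepend, List.getElem_append]

theorem Text.prepend_init (σ : DataSeq) (T : Text) :
    (Text.prepend σ T).init σ.length = σ := by
  simpa [Text.init] using Text.prepend_init_add σ T 0

theorem Text.content_prepend {σ : DataSeq} {T : Text} (h : σ.content ⊆ T.content) :
    (Text.prepend σ T).content = T.content := by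
  ext x
  constructor
  · rintro ⟨n, hn⟩
    unfold Text.prepend at hn
    split_ifs at hn with hlt
    · exact h (show some x ∈ σ from hn ▸ List.getElem_mem hlt)
    · exact ⟨_, hn⟩
  · rintro ⟨n, hn⟩
    exact ⟨σ.length + n, by simp [Text.prepend, hn]⟩

/-! ### Stagewise enumeration of computably enumerable sets -/

/-- A partial computable function is the increasing union of primitive recursive stages. -/
theorem exists_primrec_stages {α β : Type*} [Primcodable α] [Primcodable β] {f : α →. β}
    (hf : Partrec f) : ∃ g : ℕ → α → Option β, Primrec₂ g ∧
      (∀ s t a b, s ≤ t → g s a = some b → g t a = some b) ∧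
      (∀ s a b, g s a = some b → Encodable.encode a < s) ∧
      ∀ a b, b ∈ f a ↔ ∃ s, g s a = some b := by
  obtain ⟨c, hc⟩ := Nat.Partrec.Code.exists_code.1 hf
  refine ⟨fun s a => (Nat.Partrec.Code.evaln s c (Encodable.encode a)).bind Encodable.decode,
    ?_, ?_, ?_, ?_⟩
  · refine Primrec.option_bind ?_ (Primrec.decode.comp Primrec.snd)
    exact Nat.Partrec.Code.primrec_evaln.comp
      ((Primrec.fst.pair (Primrec.const c)).pair (Primrec.encode.comp Primrec.snd))
  · intro s t a b hst h
    obtain ⟨v, hv, hb⟩ := Option.bind_eq_some_iff.1 h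
    exact Option.bind_eq_some_iff.2 ⟨v, Nat.Partrec.Code.evaln_mono hst hv, hb⟩
  · intro s a b h
    obtain ⟨v, hv, -⟩ := Option.bind_eq_some_iff.1 h
    exact Nat.Partrec.Code.evaln_bound hv
  · intro a b
    have key : ∀ v, v ∈ c.eval (Encodable.encode a) ↔ ∃ b ∈ f a, Encodable.encode b = v := by
      intro v
      rw [hc]
      simp
    constructor
    · intro hb
      obtain ⟨s, hs⟩ := Nat.Partrec.Code.evaln_complete.1 ((key _).2 ⟨b, hb, rfl⟩)
      exact ⟨s, Option.bind_eq_some_iff.2 ⟨_, hs, by simp⟩⟩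
    · rintro ⟨s, hs⟩
      obtain ⟨v, hv, hb⟩ := Option.bind_eq_some_iff.1 hs
      obtain ⟨b', hb', rfl⟩ := (key v).1 (Nat.Partrec.Code.evaln_sound hv)
      simp at hb
      exact hb ▸ hb'

/-- The relation `d s e x` ("`x` is enumerated into `W φ e` by stage `s`") is a primitive
recursive enumeration of the sets `W φ e`. -/
structure IsEnumeration (φ : ℕ → ℕ →. ℕ) (d : ℕ → ℕ → ℕ → Bool) : Prop where
  primrec : Primrec fun q : ℕ × ℕ × ℕ => d q.1 q.2.1 q.2.2
  mono : ∀ {s t e x}, s ≤ t → d s e x = true → d t e x = true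
  lt_of_mem : ∀ {s e x}, d s e x = true → x < s
  mem_iff : ∀ {e x}, x ∈ W φ e ↔ ∃ s, d s e x = true

theorem IsAcceptable.exists_isEnumeration {φ : ℕ → ℕ →. ℕ} (hφ : IsAcceptable φ) :
    ∃ d, IsEnumeration φ d := by
  obtain ⟨g, hg, hmono, hlt, hmem⟩ := exists_primrec_stages hφ.1
  refine ⟨fun s e x => (g s (e, x)).isSome, ?_, ?_, ?_, ?_⟩
  · exact Primrec.option_isSome.comp (hg.comp Primrec.fst Primrec.snd)
  · intro s t e x hst h
    obtain ⟨v, hv⟩ := Option.isSome_iff_exists.1 h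
    exact Option.isSome_iff_exists.2 ⟨v, hmono _ _ _ _ hst hv⟩
  · intro s e x h
    obtain ⟨v, hv⟩ := Option.isSome_iff_exists.1 h
    exact (Nat.right_le_pair e x).trans_lt (hlt s (e, x) v hv)
  · intro e x
    constructor
    · intro h
      obtain ⟨v, hv⟩ := Part.dom_iff_mem.1 (show (φ e x).Dom from h)
      obtain ⟨s, hs⟩ := (hmem (e, x) v).1 hv
      exact ⟨s, Option.isSome_iff_exists.2 ⟨v, hs⟩⟩
    · rintro ⟨s, hs⟩
      obtain ⟨v, hv⟩ := Option.isSome_iff_exists.1 hs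
      exact Part.dom_iff_mem.2 ⟨v, (hmem (e, x) v).2 ⟨s, hv⟩⟩

theorem IsAcceptable.exists_W_eq_empty {φ : ℕ → ℕ →. ℕ} (hφ : IsAcceptable φ) :
    ∃ e, W φ e = ∅ := by
  obtain ⟨t, -, ht⟩ := hφ.2 (fun _ _ => Part.none) Partrec.none
  refine ⟨t 0, ?_⟩
  ext x
  simp only [W, ht, Set.mem_empty_iff_false, iff_false]
  exact fun h => h

/-- The content of `σ` is enumerated into `W φ e` by stage `s`. -/
def Covered (d : ℕ → ℕ → ℕ → Bool) (σ : DataSeq) (s e : ℕ) : Prop :=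
  ∀ x ∈ σ.content, d s e x = true

namespace IsEnumeration

variable {φ : ℕ → ℕ →. ℕ} {d : ℕ → ℕ → ℕ → Bool}

theorem primrec_covered (hd : IsEnumeration φ d) :
    PrimrecPred fun q : DataSeq × ℕ × ℕ => Covered d q.1 q.2.1 q.2.2 := by
  have hR : PrimrecRel fun (a : Option ℕ) (q : ℕ × ℕ) =>
      (a.casesOn true fun x => d q.1 q.2 x : Bool) = true := by
    refine Primrec.eq.comp (Primrec.option_casesOn Primrec.fst (Primrec.const true) ?_)
      (Primrec.const true)
    exact (hd.primrec.comp ((Primrec.fst.comp (Primrec.snd.comp Primrec.fst)).pair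
      ((Primrec.snd.comp (Primrec.snd.comp Primrec.fst)).pair Primrec.snd))).to₂
  refine PrimrecPred.of_eq (PrimrecRel.forall_mem_list hR) fun q => ?_
  constructor
  · intro h x hx
    exact h _ hx
  · rintro h (_ | x) hx
    · rfl
    · exact h x hx

theorem covered_mono (hd : IsEnumeration φ d) {σ : DataSeq} {s t e : ℕ} (hst : s ≤ t)
    (h : Covered d σ s e) : Covered d σ t e :=
  fun x hx => hd.mono hst (h x hx)

theorem content_subset (hd : IsEnumeration φ d) {σ : DataSeq} {s e : ℕ}
    (h : Covered d σ s e) : σ.content ⊆ W φ e :=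
  fun x hx => hd.mem_iff.2 ⟨s, h x hx⟩

theorem exists_covered (hd : IsEnumeration φ d) {σ : DataSeq} {e : ℕ}
    (h : σ.content ⊆ W φ e) : ∃ s, Covered d σ s e := by
  have : ∀ x, ∃ s, x ∈ σ.content → d s e x = true := by
    intro x
    by_cases hx : x ∈ σ.content
    · obtain ⟨s, hs⟩ := hd.mem_iff.1 (h hx)
      exact ⟨s, fun _ => hs⟩
    · exact ⟨0, fun h => absurd h hx⟩
  choose s hs using this
  obtain ⟨B, hB⟩ := (σ.content_finite.image s).bddAbove
  exact ⟨B, fun x hx => hd.mono (hB ⟨x, hx, rfl⟩) (hs x hx)⟩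

end IsEnumeration

/-! ### Delayed consistent learners -/

/-- Every partial learner can be replaced by a primitive recursive one which, on every text on
which the given learner is total, first conjectures the empty set and then repeats, in their
order, conjectures of the given learner that contain the data they were based on. -/
theorem IsAcceptable.exists_consistent_learner {φ : ℕ → ℕ →. ℕ} (hφ : IsAcceptable φ)
    {h : DataSeq →. ℕ} (hh : Partrec h) :
    ∃ h' : DataSeq → ℕ, Primrec h' ∧ ∀ T : Text, ∀ p : ℕ → ℕ, (∀ i, p i ∈ G h T i) →
      ∃ (P : ℕ → Prop) (k : ℕ → ℕ),
        (∀ i, ¬ P i → W φ (h' (T.init i)) = ∅) ∧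
        (∀ i, P i → h' (T.init i) = p (k i) ∧ (T.init (k i)).content ⊆ W φ (p (k i))) ∧
        (∀ i j, i ≤ j → P i → P j ∧ k i ≤ k j) ∧
        (Ex φ p T → Ex φ (fun i => h' (T.init i)) T) := by
  classical
  obtain ⟨d, hd⟩ := hφ.exists_isEnumeration
  obtain ⟨e₀, he₀⟩ := hφ.exists_W_eq_empty
  obtain ⟨g, hg, gmono, -, gmem⟩ := exists_primrec_stages hh
  -- The length of `ρ` serves as time bound: within it, the conjecture on the first `k` data is
  -- computed and seen to contain them. `K` picks the latest such `k`.
  let Q : DataSeq → ℕ → Prop := fun ρ k => (g ρ.length (ρ.take k)).isSome = true ∧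
    Covered d (ρ.take k) ρ.length ((g ρ.length (ρ.take k)).getD 0)
  let K : DataSeq → ℕ := fun ρ => Nat.findGreatest (Q ρ) ρ.length
  let h' : DataSeq → ℕ := fun ρ => if Q ρ (K ρ) then (g ρ.length (ρ.take (K ρ))).getD 0 else e₀
  have hlen : Primrec fun q : DataSeq × ℕ => q.1.length := Primrec.list_length.comp Primrec.fst
  have htake : Primrec fun q : DataSeq × ℕ => q.1.take q.2 :=
    Primrec.list_take.comp Primrec.snd Primrec.fst
  have hgt : Primrec fun q : DataSeq × ℕ => g q.1.length (q.1.take q.2) := hg.comp hlen htake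
  have hgd : Primrec fun q : DataSeq × ℕ => (g q.1.length (q.1.take q.2)).getD 0 :=
    Primrec.option_getD.comp hgt (Primrec.const 0)
  have hQ : PrimrecRel Q :=
    (Primrec.eq.comp (Primrec.option_isSome.comp hgt) (Primrec.const true)).and
      (hd.primrec_covered.comp (htake.pair (hlen.pair hgd)))
  have hK : Primrec K := Primrec.nat_findGreatest Primrec.list_length hQ
  have hidK : Primrec fun ρ : DataSeq => (ρ, K ρ) := Primrec.id.pair hK
  refine ⟨h', Primrec.ite (hQ.comp Primrec.id hK) (hgd.comp hidK) (Primrec.const e₀), ?_⟩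
  intro T p hp
  have hgp : ∀ {s k v}, g s (T.init k) = some v → v = p k := fun {s k v} hv =>
    Part.mem_unique ((gmem _ _).2 ⟨s, hv⟩) (hp k)
  have hQT : ∀ {i k}, k ≤ i → (Q (T.init i) k ↔
      g i (T.init k) = some (p k) ∧ Covered d (T.init k) i (p k)) := by
    intro i k hk
    simp only [Q, Text.length_init, Text.take_init T hk]
    constructor
    · rintro ⟨h₁, h₂⟩
      obtain ⟨v, hv⟩ := Option.isSome_iff_exists.1 h₁
      obtain rfl := hgp hv
      rw [hv] at h₂
      exact ⟨hv, h₂⟩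
    · rintro ⟨h₁, h₂⟩
      rw [h₁]
      exact ⟨rfl, h₂⟩
  have hQmono : ∀ {i j k}, i ≤ j → k ≤ i → Q (T.init i) k → Q (T.init j) k := by
    intro i j k hij hk hq
    obtain ⟨h₁, h₂⟩ := (hQT hk).1 hq
    exact (hQT (hk.trans hij)).2 ⟨gmono _ _ _ _ hij h₁, hd.covered_mono hij h₂⟩
  have hKle : ∀ i, K (T.init i) ≤ i := fun i =>
    (Nat.findGreatest_le _).trans_eq (T.length_init i)
  have hKspec : ∀ {i k}, k ≤ i → Q (T.init i) k →
      Q (T.init i) (K (T.init i)) ∧ k ≤ K (T.init i) := by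
    intro i k hk hq
    have hk' : k ≤ (T.init i).length := by rwa [Text.length_init]
    exact ⟨Nat.findGreatest_spec hk' hq, Nat.le_findGreatest hk' hq⟩
  have hval : ∀ i, Q (T.init i) (K (T.init i)) → h' (T.init i) = p (K (T.init i)) := by
    intro i hq
    have := ((hQT (hKle i)).1 hq).1
    simp only [h', if_pos hq, Text.length_init, Text.take_init T (hKle i), this, Option.getD_some]
  refine ⟨fun i => Q (T.init i) (K (T.init i)), fun i => K (T.init i), ?_, ?_, ?_, ?_⟩
  · intro i hi
    simp only [h', if_neg hi, he₀]
  · intro i hi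
    exact ⟨hval i hi, hd.content_subset ((hQT (hKle i)).1 hi).2⟩
  · intro i j hij hi
    exact hKspec ((hKle i).trans hij) (hQmono hij (hKle i) hi)
  · rintro ⟨n₀, hn₀⟩
    have hW := (hn₀ n₀ le_rfl).2
    obtain ⟨s, hs⟩ := (gmem _ _).1 (hp n₀)
    obtain ⟨s', hs'⟩ := hd.exists_covered ((T.content_init_subset n₀).trans hW.superset)
    -- From here on `n₀` itself qualifies, so the chosen prefix is at least that long and its
    -- conjecture is the limit.
    have key : ∀ i ≥ max n₀ (max s s'), h' (T.init i) = p n₀ := by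
      intro i hi
      have h1 : n₀ ≤ i := (le_max_left _ _).trans hi
      have h2 : s ≤ i := (le_max_left s s').trans ((le_max_right _ _).trans hi)
      have h3 : s' ≤ i := (le_max_right s s').trans ((le_max_right _ _).trans hi)
      obtain ⟨hq, hle⟩ := hKspec h1 ((hQT h1).2 ⟨gmono _ _ _ _ h2 hs, hd.covered_mono h3 hs'⟩)
      rw [hval i hq, (hn₀ _ hle).1]
    exact ⟨max n₀ (max s s'), fun i hi => ⟨by simp only [key i hi, key _ le_rfl],
      by simp only [key _ le_rfl]; exact hW⟩⟩

/-! ### Locking sequences -/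

theorem exists_text_init_of_chain (σ τ : ℕ → DataSeq)
    (h : ∀ n, σ (n + 1) = σ n ++ τ n) (hne : ∀ n, τ n ≠ []) :
    ∃ T : Text, ∀ n, T.init (σ n).length = σ n := by
  have hlen : ∀ n, n ≤ (σ n).length := by
    intro n
    induction n with
    | zero => exact Nat.zero_le _
    | succ n ih =>
      have := List.length_pos_iff.2 (hne n)
      rw [h, List.length_append]
      omega
  have hpre : ∀ m n, m ≤ n → σ m <+: σ n := by
    intro m n hmn
    induction n, hmn using Nat.le_induction with
    | base => exact List.prefix_rfl
    | succ n _ ih => exact ih.trans (h n ▸ List.prefix_append _ _)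
  -- The default `none` is never used, since `σ (i + 1)` has length at least `i + 1`.
  refine ⟨fun i => (σ (i + 1)).getD i none, fun n => ?_⟩
  apply List.ext_getElem
  · simp [Text.init]
  · intro i h₁ h₂
    have hi : i < (σ (i + 1)).length := hlen (i + 1)
    simp only [Text.init, List.getElem_map, List.getElem_range]
    rw [← List.getElem_eq_getD (h := hi)]
    rcases le_total (i + 1) n with hle | hle
    · exact (hpre _ _ hle).getElem hi
    · exact ((hpre _ _ hle).getElem h₂).symm

/-- Blum and Blum: a learner of `L` has a locking sequence on `L`. -/
theorem exists_locking_sequence {φ : ℕ → ℕ →. ℕ} {h : DataSeq → ℕ} {L : Set ℕ}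
    (hL : ∀ T : Text, T.content = L → Ex φ (fun i => h (T.init i)) T) :
    ∃ σ : DataSeq, σ.content ⊆ L ∧ W φ (h σ) = L ∧
      ∀ τ : DataSeq, τ.content ⊆ L → h (σ ++ τ) = h σ := by
  by_contra! hcon
  have hext : ∀ σ : DataSeq, ∃ τ : DataSeq, τ.content ⊆ L ∧
      (σ.content ⊆ L → W φ (h σ) = L → h (σ ++ τ) ≠ h σ) := by
    intro σ
    by_cases h₁ : σ.content ⊆ L
    · by_cases h₂ : W φ (h σ) = L
      · obtain ⟨τ, hτ, hne⟩ := hcon σ h₁ h₂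
        exact ⟨τ, hτ, fun _ _ => hne⟩
      · exact ⟨[], by simp [DataSeq.content], fun _ h => absurd h h₂⟩
    · exact ⟨[], by simp [DataSeq.content], fun h => absurd h h₁⟩
  choose ext hextL hextne using hext
  obtain ⟨T₀, hT₀⟩ := exists_text L
  -- Interleave a text for `L`, which secures the full content, with extensions that provoke a mind
  -- change after each correct conjecture.
  let step : ℕ → DataSeq → DataSeq := fun n σ => [T₀ n] ++ ext (σ ++ [T₀ n])
  obtain ⟨s, hs₀, hs⟩ : ∃ s : ℕ → DataSeq, s 0 = [] ∧ ∀ n, s (n + 1) = s n ++ step n (s n) :=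
    ⟨fun n => Nat.rec [] (fun n σ => σ ++ step n σ) n, rfl, fun _ => rfl⟩
  have hslen : ∀ m, m ≤ (s m).length := by
    intro m
    induction m with
    | zero => exact Nat.zero_le _
    | succ m ih => simp only [hs, step, List.length_append, List.length_singleton]; omega
  have hsing : ∀ n, DataSeq.content [T₀ n] ⊆ L := by
    intro n x hx
    rw [← hT₀]
    exact ⟨n, by simpa [DataSeq.content, eq_comm] using hx⟩
  have hsL : ∀ n, (s n).content ⊆ L := by
    intro n
    induction n with
    | zero => simp [hs₀, DataSeq.content]
    | succ n ih =>
      rw [hs, DataSeq.content_append, DataSeq.content_append]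
      exact Set.union_subset ih (Set.union_subset (hsing n) (hextL _))
  obtain ⟨T, hT⟩ := exists_text_init_of_chain s (fun n => step n (s n)) hs (by simp [step])
  have hTc : T.content = L := by
    apply Set.Subset.antisymm
    · rintro x ⟨n, hn⟩
      apply hsL (n + 1)
      rw [← hT (n + 1)]
      exact Text.mem_content_init.2 ⟨n, hslen (n + 1), hn⟩
    · intro x hx
      rw [← hT₀] at hx
      obtain ⟨n, hn⟩ := hx
      apply T.content_init_subset (s (n + 1)).length
      rw [hT (n + 1), hs]
      simp [step, DataSeq.content, hn]
  obtain ⟨n₀, hn₀⟩ := hL T hTc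
  have hlen := hslen n₀
  have hinit : T.init ((s n₀).length + 1) = s n₀ ++ [T₀ n₀] := by
    have h1 : (s n₀).length + 1 ≤ (s (n₀ + 1)).length := by
      simp only [hs, step, List.length_append, List.length_singleton]; omega
    rw [← T.take_init h1, hT (n₀ + 1), hs]
    simp [step, List.take_append]
  have hc₁ := hn₀ ((s n₀).length + 1) (by omega)
  have hc₂ := hn₀ (s (n₀ + 1)).length
    (by simp only [hs, step, List.length_append, List.length_singleton]; omega)
  simp only [hinit, hT] at hc₁ hc₂
  refine hextne (s n₀ ++ [T₀ n₀]) ?_ ?_ ?_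
  · rw [DataSeq.content_append]
    exact Set.union_subset (hsL _) (hsing _)
  · rw [hc₁.1, hc₁.2, hTc]
  · rw [hc₁.1, ← hc₂.1, hs]
    simp [step]

/-! ### Poisoned conjectures and the search for a candidate -/

/-- The finite sequence with a given code (`[]` if there is none). -/
def seqOf (c : ℕ) : DataSeq := (Encodable.decode (α := DataSeq) c).getD []

theorem primrec_seqOf : Primrec seqOf :=
  Primrec.option_getD.comp Primrec.decode (Primrec.const [])

theorem seqOf_encode (σ : DataSeq) : seqOf (Encodable.encode σ) = σ := by
  simp [seqOf]

theorem primrec_content_subset :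
    PrimrecRel fun σ ρ : DataSeq => σ.content ⊆ DataSeq.content ρ := by
  have hmem : PrimrecRel fun (a : Option ℕ) (ρ : DataSeq) => ∃ b ∈ ρ, b = a :=
    (PrimrecRel.exists_mem_list Primrec.eq).comp Primrec.snd Primrec.fst
  have hR : PrimrecRel fun (a : Option ℕ) (ρ : DataSeq) => a = none ∨ ∃ b ∈ ρ, b = a :=
    (Primrec.eq.comp Primrec.fst (Primrec.const none)).or hmem
  refine PrimrecPred.of_eq (PrimrecRel.forall_mem_list hR) fun q => ?_
  constructor
  · intro h x hx
    simpa [DataSeq.content] using h _ hx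
  · rintro h (_ | x) hx
    · exact Or.inl rfl
    · exact Or.inr ⟨_, h hx, rfl⟩

section Poisoning

variable (d : ℕ → ℕ → ℕ → Bool) (h : DataSeq → ℕ)

/-- At stage `s`, no extension of `σ` by data from the conjecture `h σ` is known on which `h`
changes its mind. -/
def Stable (σ : DataSeq) (s : ℕ) : Prop :=
  ∀ c < s, Covered d (seqOf c) s (h σ) → h (σ ++ seqOf c) = h σ

/-- The part of `W φ (h σ)` enumerated while `σ` is stable. -/
def stablePart (σ : DataSeq) : Set ℕ := {x | ∃ s, Stable d h σ s ∧ d s (h σ) x = true}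

/-- A sufficient criterion for `ρ` to contain data outside the stable part of `h σ`. -/
def Refuted (σ ρ : DataSeq) : Prop :=
  (∀ s < ρ.length + Encodable.encode ρ + 1, ¬ (Stable d h σ s ∧ Covered d ρ s (h σ))) ∧
    (h (σ ++ ρ) ≠ h σ ∨ ¬ Stable d h σ (ρ.length + Encodable.encode ρ + 1))

open Classical in
/-- The code of the first sequence which may replace a refuted one. -/
noncomputable def replacement (ρ : DataSeq) : ℕ :=
  (List.range ρ.length).findIdx fun c =>
    decide ((seqOf c).content ⊆ ρ.content ∧ ¬ Refuted d h (seqOf c) ρ)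

open Classical in
/-- Replace `σ` if it is refuted by `ρ` and a replacement is known. -/
noncomputable def revise (σ ρ : DataSeq) : DataSeq :=
  if Refuted d h σ ρ ∧ replacement d h ρ < ρ.length then seqOf (replacement d h ρ) else σ

/-- The candidate for a locking sequence after seeing `ρ`. -/
noncomputable def candidate (ρ : DataSeq) : DataSeq :=
  Nat.rec [] (fun m σ => revise d h σ (ρ.take (m + 1))) ρ.length

variable {d h} {φ : ℕ → ℕ →. ℕ}

theorem primrec_stable (hd : IsEnumeration φ d) (hh : Primrec h) : PrimrecRel (Stable d h) := by
  have hR : PrimrecRel fun (c : ℕ) (q : DataSeq × ℕ) =>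
      ¬ Covered d (seqOf c) q.2 (h q.1) ∨ h (q.1 ++ seqOf c) = h q.1 := by
    have hσ : Primrec fun q : ℕ × DataSeq × ℕ => q.2.1 := Primrec.fst.comp Primrec.snd
    have hs : Primrec fun q : ℕ × DataSeq × ℕ => q.2.2 := Primrec.snd.comp Primrec.snd
    have hc : Primrec fun q : ℕ × DataSeq × ℕ => seqOf q.1 := primrec_seqOf.comp Primrec.fst
    exact (hd.primrec_covered.comp (hc.pair (hs.pair (hh.comp hσ)))).not.or
      (Primrec.eq.comp (hh.comp (Primrec.list_append.comp hσ hc)) (hh.comp hσ))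
  have hF := hR.forall_mem_list
  refine PrimrecPred.of_eq (hF.comp (Primrec.list_range.comp Primrec.snd)
    (Primrec.fst.pair Primrec.snd)) fun q => ?_
  simp only [List.mem_range, Stable, imp_iff_not_or]

theorem primrec_refuted (hd : IsEnumeration φ d) (hh : Primrec h) : PrimrecRel (Refuted d h) := by
  have hn : Primrec fun q : DataSeq × DataSeq => q.2.length + Encodable.encode q.2 + 1 :=
    Primrec.succ.comp (Primrec.nat_add.comp (Primrec.list_length.comp Primrec.snd)
      (Primrec.encode.comp Primrec.snd))
  have hR : PrimrecRel fun (s : ℕ) (q : DataSeq × DataSeq) =>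
      ¬ (Stable d h q.1 s ∧ Covered d q.2 s (h q.1)) := by
    have hσ : Primrec fun q : ℕ × DataSeq × DataSeq => q.2.1 := Primrec.fst.comp Primrec.snd
    have hρ : Primrec fun q : ℕ × DataSeq × DataSeq => q.2.2 := Primrec.snd.comp Primrec.snd
    exact (((primrec_stable hd hh).comp hσ Primrec.fst).and
      (hd.primrec_covered.comp (hρ.pair (Primrec.fst.pair (hh.comp hσ))))).not
  have hF := hR.forall_mem_list
  refine PrimrecPred.and (PrimrecPred.of_eq (hF.comp (Primrec.list_range.comp hn)
      (Primrec.fst.pair Primrec.snd)) fun q => by simp only [List.mem_range])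
    ((Primrec.eq.comp (hh.comp (Primrec.list_append.comp Primrec.fst Primrec.snd))
      (hh.comp Primrec.fst)).not.or ((primrec_stable hd hh).comp Primrec.fst hn).not)

theorem primrec_candidate (hd : IsEnumeration φ d) (hh : Primrec h) :
    Primrec (candidate d h) := by
  classical
  have href := primrec_refuted hd hh
  have hrep : Primrec (replacement d h) := by
    refine Primrec.list_findIdx (Primrec.list_range.comp Primrec.list_length) ?_
    have hc : Primrec fun q : DataSeq × ℕ => seqOf q.2 := primrec_seqOf.comp Primrec.snd
    exact PrimrecPred.decide ((primrec_content_subset.comp hc Primrec.fst).and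
      (href.comp hc Primrec.fst).not)
  have hrev : Primrec₂ (revise d h) :=
    Primrec.ite (href.and (Primrec.nat_lt.comp (hrep.comp Primrec.snd)
      (Primrec.list_length.comp Primrec.snd)))
      (primrec_seqOf.comp (hrep.comp Primrec.snd)) Primrec.fst
  have hstep : Primrec₂ fun (ρ : DataSeq) (q : ℕ × DataSeq) =>
      revise d h q.2 (ρ.take (q.1 + 1)) := hrev.comp (Primrec.snd.comp Primrec.snd) (Primrec.list_take.comp
    (Primrec.succ.comp (Primrec.fst.comp Primrec.snd)) Primrec.fst)
  exact Primrec.nat_rec' Primrec.list_length (Primrec.const []) hstep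

theorem candidate_init_zero (T : Text) : candidate d h (T.init 0) = [] := rfl

theorem candidate_init_succ (T : Text) (n : ℕ) :
    candidate d h (T.init (n + 1)) = revise d h (candidate d h (T.init n)) (T.init (n + 1)) := by
  have key : ∀ N m, m ≤ N → (Nat.rec [] (fun m σ => revise d h σ ((T.init N).take (m + 1))) m :
      DataSeq) = Nat.rec [] (fun m σ => revise d h σ (T.init (m + 1))) m := by
    intro N m hm
    induction m with
    | zero => rfl
    | succ m ih => simp only [ih (by omega), T.take_init hm]
  unfold candidate
  simp only [Text.length_init]
  exact (key (n + 1) (n + 1) le_rfl).trans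
    (congrArg (fun τ => revise d h τ (T.init (n + 1))) (key n n le_rfl).symm)

theorem stable_antitone (hd : IsEnumeration φ d) {σ : DataSeq} {s t : ℕ} (hst : s ≤ t)
    (ht : Stable d h σ t) : Stable d h σ s :=
  fun c hc hcov => ht c (hc.trans_le hst) (hd.covered_mono hst hcov)

theorem stablePart_subset (hd : IsEnumeration φ d) (σ : DataSeq) :
    stablePart d h σ ⊆ W φ (h σ) := by
  rintro x ⟨s, -, hs⟩
  exact hd.mem_iff.2 ⟨s, hs⟩

theorem stablePart_eq (hd : IsEnumeration φ d) {σ : DataSeq} (hσ : ∀ s, Stable d h σ s) :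
    stablePart d h σ = W φ (h σ) := by
  refine (stablePart_subset hd σ).antisymm fun x hx => ?_
  obtain ⟨s, hs⟩ := hd.mem_iff.1 hx
  exact ⟨s, hσ s, hs⟩

/-- Nothing is enumerated after stability is lost, and only numbers below the stage number can be
enumerated by a given stage. -/
theorem stablePart_finite_of_not_stable (hd : IsEnumeration φ d) {σ : DataSeq} {s : ℕ}
    (hs : ¬ Stable d h σ s) : (stablePart d h σ).Finite := by
  refine (Set.finite_Iio s).subset ?_
  rintro x ⟨t, ht, hx⟩
  have : t ≤ s := by
    by_contra hlt
    exact hs (stable_antitone hd (by omega) ht)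
  exact (hd.lt_of_mem hx).trans_le this

theorem exists_stable_covered (hd : IsEnumeration φ d) {σ ρ : DataSeq}
    (hsub : ρ.content ⊆ stablePart d h σ) : ∃ s, Stable d h σ s ∧ Covered d ρ s (h σ) := by
  by_cases hσ : ∀ s, Stable d h σ s
  · obtain ⟨s, hs⟩ := hd.exists_covered (hsub.trans (stablePart_subset hd σ))
    exact ⟨s, hσ s, hs⟩
  · have h0 : Stable d h σ 0 := fun c hc => absurd hc (Nat.not_lt_zero c)
    classical
    push Not at hσ
    obtain ⟨b, hb⟩ := hσ
    -- The last stable stage has enumerated the whole stable part.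
    have hspec := Nat.findGreatest_spec (P := Stable d h σ) (Nat.zero_le b) h0
    refine ⟨_, hspec, fun x hx => ?_⟩
    obtain ⟨s, hs, hsx⟩ := hsub hx
    refine hd.mono (Nat.le_findGreatest ?_ hs) hsx
    by_contra hlt
    exact hb (stable_antitone hd (by omega) hs)

/-- A stable stage covering `ρ` can only lie beyond the bound in `Refuted`. Such a stage exceeds the
code of `ρ`, so stability there already tests `ρ` as an extension and excludes a mind change. -/
theorem not_refuted (hd : IsEnumeration φ d) {σ ρ : DataSeq}
    (hsub : ρ.content ⊆ stablePart d h σ) : ¬ Refuted d h σ ρ := by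
  rintro ⟨h₁, h₂⟩
  obtain ⟨s, hs, hcov⟩ := exists_stable_covered hd hsub
  have hle : ρ.length + Encodable.encode ρ + 1 ≤ s := by
    by_contra hlt
    exact h₁ s (by omega) ⟨hs, hcov⟩
  rcases h₂ with h₂ | h₂
  · have := hs (Encodable.encode ρ) (by omega)
    rw [seqOf_encode] at this
    exact h₂ (this hcov)
  · exact h₂ (stable_antitone hd hle hs)

/-- Once a missing element appears, no stage covers the data. If stability fails, the growing bound
detects it; otherwise `h` must change its mind on `σ` followed by the text, because `W φ (h σ)` is
not the target. -/
theorem eventually_refuted (hd : IsEnumeration φ d) {L : Set ℕ}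
    (hL : ∀ T : Text, T.content = L → Ex φ (fun i => h (T.init i)) T) {T : Text}
    (hT : T.content = L) {σ : DataSeq} (hσ : σ.content ⊆ L) (hn' : ¬ L ⊆ stablePart d h σ) :
    ∃ N, ∀ n ≥ N, Refuted d h σ (T.init n) := by
  obtain ⟨x, hxL, hx⟩ := Set.not_subset.1 hn'
  obtain ⟨m, hm⟩ : x ∈ T.content := hT ▸ hxL
  have hfirst : ∀ n ≥ m + 1, ∀ s, ¬ (Stable d h σ s ∧ Covered d (T.init n) s (h σ)) := by
    rintro n hn s ⟨hs, hcov⟩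
    exact hx ⟨s, hs, hcov x (Text.mem_content_init.2 ⟨m, hn, hm⟩)⟩
  by_cases hst : ∀ s, Stable d h σ s
  · have hprep : (Text.prepend σ T).content = L := (Text.content_prepend (hT ▸ hσ)).trans hT
    obtain ⟨n₀, hn₀⟩ := hL _ hprep
    refine ⟨max (m + 1) n₀, fun n hn => ⟨fun s _ => hfirst n ((le_max_left _ _).trans hn) s,
      Or.inl fun heq => hn' ?_⟩⟩
    have hn₁ : n₀ ≤ σ.length + n := by have := (le_max_right _ _).trans hn; omega
    have h₁ := hn₀ _ hn₁
    simp only [Text.prepend_init_add, heq] at h₁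
    rw [stablePart_eq hd hst, h₁.1, h₁.2, hprep]
  · push Not at hst
    obtain ⟨s, hs⟩ := hst
    refine ⟨max (m + 1) s, fun n hn => ⟨fun s _ => hfirst n ((le_max_left _ _).trans hn) s,
      Or.inr fun hs' => hs (stable_antitone hd ?_ hs')⟩⟩
    rw [Text.length_init]
    have := (le_max_right _ _).trans hn
    omega

end Poisoning

/-! ### Convergence and the conservative learner -/

variable {φ : ℕ → ℕ →. ℕ} {d : ℕ → ℕ → ℕ → Bool} {h : DataSeq → ℕ}

theorem revise_of_not_refuted {σ ρ : DataSeq} (hn : ¬ Refuted d h σ ρ) :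
    revise d h σ ρ = σ :=
  if_neg fun hr => hn hr.1

theorem content_revise_subset {σ ρ : DataSeq} {L : Set ℕ} (hσ : σ.content ⊆ L)
    (hρ : ρ.content ⊆ L) : (revise d h σ ρ).content ⊆ L := by
  unfold revise
  split_ifs with hr
  · have hlt : replacement d h ρ < (List.range ρ.length).length := by
      simpa only [List.length_range] using hr.2
    have hsub := List.findIdx_getElem (w := hlt)
    simp only [decide_eq_true_eq] at hsub
    have heq : (List.range ρ.length)[replacement d h ρ] = replacement d h ρ :=
      List.getElem_range hlt
    exact (congrArg (fun c => (seqOf c).content) heq).symm.subset.trans (hsub.1.trans hρ)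
  · exact hσ

theorem revise_eq_seqOf {σ ρ : DataSeq} (hr : Refuted d h σ ρ) {c : ℕ} (hc : c < ρ.length)
    (hsub : (seqOf c).content ⊆ ρ.content) (hnr : ¬ Refuted d h (seqOf c) ρ)
    (hmin : ∀ b < c, (seqOf b).content ⊆ ρ.content → Refuted d h (seqOf b) ρ) :
    revise d h σ ρ = seqOf c := by
  have hrep : replacement d h ρ = c := by
    unfold replacement
    rw [List.findIdx_eq (by simpa using hc)]
    simp only [List.getElem_range, decide_eq_true_eq, decide_eq_false_iff_not]
    exact ⟨⟨hsub, hnr⟩, fun b hb hb' => hb'.2 (hmin b hb hb'.1)⟩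
  rw [revise, if_pos ⟨hr, hrep ▸ hc⟩, hrep]

theorem content_candidate_subset (T : Text) (n : ℕ) :
    (candidate d h (T.init n)).content ⊆ T.content := by
  induction n with
  | zero => simp [candidate_init_zero, DataSeq.content]
  | succ n ih =>
    rw [candidate_init_succ]
    exact content_revise_subset ih (T.content_init_subset _)

/-- The candidates converge to a sequence whose stable part contains the target. -/
theorem candidate_converges (hd : IsEnumeration φ d) {L : Set ℕ}
    (hL : ∀ T : Text, T.content = L → Ex φ (fun i => h (T.init i)) T) {T : Text}
    (hT : T.content = L) :
    ∃ n₀, L ⊆ stablePart d h (candidate d h (T.init n₀)) ∧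
      ∀ n ≥ n₀, candidate d h (T.init n) = candidate d h (T.init n₀) := by
  classical
  -- A locking sequence is stable forever; the least suitable code is used below.
  have hex : ∃ c, (seqOf c).content ⊆ L ∧ L ⊆ stablePart d h (seqOf c) := by
    obtain ⟨σ, hσ, hW, hlock⟩ := exists_locking_sequence hL
    refine ⟨Encodable.encode σ, ?_⟩
    rw [seqOf_encode]
    refine ⟨hσ, ?_⟩
    rw [stablePart_eq hd, hW]
    exact fun s c _ hcov => hlock _ ((hd.content_subset hcov).trans hW.subset)
  obtain ⟨hc₁, hc₂⟩ := Nat.find_spec hex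
  have hmin := fun {b} => Nat.find_min hex (m := b)
  generalize Nat.find hex = c at hc₁ hc₂ hmin
  have hnever : ∀ {σ : DataSeq} n, L ⊆ stablePart d h σ → ¬ Refuted d h σ (T.init n) :=
    fun n hs => not_refuted hd ((T.content_init_subset n).trans (hT.subset.trans hs))
  -- Smaller codes drop out in two ways: sequences with data outside `L` are never admissible, and
  -- the others are eventually refuted.
  have hev : ∀ b, ∃ N, b < c → ∀ n ≥ N, (seqOf b).content ⊆ (T.init n).content →
      Refuted d h (seqOf b) (T.init n) := by
    intro b
    by_cases hb : b < c ∧ (seqOf b).content ⊆ L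
    · obtain ⟨N, hN⟩ := eventually_refuted hd hL hT hb.2 fun hs => hmin hb.1 ⟨hb.2, hs⟩
      exact ⟨N, fun _ n hn _ => hN n hn⟩
    · exact ⟨0, fun hbc n _ hsub =>
        absurd ⟨hbc, hsub.trans ((T.content_init_subset n).trans hT.subset)⟩ hb⟩
  choose N hN using hev
  obtain ⟨B, hB⟩ := ((Set.finite_Iio c).image N).bddAbove
  obtain ⟨m, hm⟩ := T.exists_content_init_superset (seqOf c).content_finite
    (hc₁.trans hT.superset)
  have hkeep : ∀ {n₀}, L ⊆ stablePart d h (candidate d h (T.init n₀)) →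
      ∀ n ≥ n₀, candidate d h (T.init n) = candidate d h (T.init n₀) := by
    intro n₀ hs n hn
    induction n, hn using Nat.le_induction with
    | base => rfl
    | succ n _ ih =>
      rw [candidate_init_succ, ih, revise_of_not_refuted (hnever _ hs)]
  let n₁ := max B (max m (c + 1))
  -- Any late revision lands on `seqOf c`, which is never refuted. Without late revisions the
  -- candidate is constant and unrefuted, so its stable part contains `L`.
  by_cases hchange : ∃ n ≥ n₁, Refuted d h (candidate d h (T.init n)) (T.init (n + 1))
  · obtain ⟨n, hn, hr⟩ := hchange
    have hnB : B ≤ n := (le_max_left _ _).trans hn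
    have hnm : m ≤ n := (le_max_left _ _).trans ((le_max_right _ _).trans hn)
    have hnc : c + 1 ≤ n := (le_max_right _ _).trans ((le_max_right _ _).trans hn)
    have heq : candidate d h (T.init (n + 1)) = seqOf c := by
      rw [candidate_init_succ]
      refine revise_eq_seqOf hr ?_ (hm.trans (T.content_init_mono (by omega)))
        (hnever _ hc₂) fun b hb => hN b hb _ ?_
      · rw [Text.length_init]
        omega
      · exact (hB ⟨b, hb, rfl⟩).trans (by omega)
    have hs : L ⊆ stablePart d h (candidate d h (T.init (n + 1))) := heq ▸ hc₂
    exact ⟨n + 1, hs, hkeep hs⟩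
  · push Not at hchange
    have hconst : ∀ n ≥ n₁, candidate d h (T.init n) = candidate d h (T.init n₁) := by
      intro n hn
      induction n, hn using Nat.le_induction with
      | base => rfl
      | succ n hn ih => rw [candidate_init_succ, revise_of_not_refuted (hchange n hn), ih]
    refine ⟨n₁, ?_, hconst⟩
    by_contra hns
    obtain ⟨M, hM⟩ := eventually_refuted hd hL hT
      ((content_candidate_subset T n₁).trans hT.subset) hns
    have h₁ : n₁ ≤ max n₁ M := le_max_left _ _
    apply hchange _ h₁
    rw [hconst _ h₁]
    exact hM _ ((le_max_right _ _).trans (Nat.le_succ _))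

/-- A stable part never contains a target of an explanatory learner properly, provided that the
conjectures of the learner do not properly contain finite targets. -/
theorem not_ssubset_stablePart (hd : IsEnumeration φ d) {L : Set ℕ}
    (hL : ∀ T : Text, T.content = L → Ex φ (fun i => h (T.init i)) T)
    (hfin : L.Finite → ∀ σ : DataSeq, σ.content ⊆ L → ¬ L ⊂ W φ (h σ))
    {σ : DataSeq} (hσ : σ.content ⊆ L) : ¬ L ⊂ stablePart d h σ := by
  intro hss
  by_cases hLfin : L.Finite
  · exact hfin hLfin σ hσ (hss.trans_subset (stablePart_subset hd σ))
  have hst : ∀ s, Stable d h σ s := by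
    by_contra! hns
    obtain ⟨s, hs⟩ := hns
    exact hLfin ((stablePart_finite_of_not_stable hd hs).subset hss.subset)
  rw [stablePart_eq hd hst] at hss
  obtain ⟨T, hT⟩ := exists_text L
  have hprep : (Text.prepend σ T).content = L := (Text.content_prepend (hT ▸ hσ)).trans hT
  obtain ⟨n₀, hn₀⟩ := hL _ hprep
  have hcov : (T.init n₀).content ⊆ W φ (h σ) :=
    (T.content_init_subset n₀).trans (hT.subset.trans hss.subset)
  obtain ⟨s, hs⟩ := hd.exists_covered hcov
  -- `Stable` tests only codes strictly below the stage, hence the `+ 1`.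
  have h₁ := hst (max s (Encodable.encode (T.init n₀) + 1)) (Encodable.encode (T.init n₀))
    (by omega)
  rw [seqOf_encode] at h₁
  have h₂ := hn₀ (σ.length + n₀) (by omega)
  simp only [Text.prepend_init_add, h₁ (hd.covered_mono (le_max_left _ _) hs)] at h₂
  rw [h₂.1, h₂.2, hprep] at hss
  exact hss.ne rfl

theorem exists_index_stablePart (hφ : IsAcceptable φ) (hd : IsEnumeration φ d)
    (hh : Primrec h) : ∃ t : DataSeq → ℕ, Computable t ∧
      ∀ σ, W φ (t σ) = stablePart d h σ := by
  classical
  have hP : PrimrecRel fun (q : ℕ × ℕ) (s : ℕ) =>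
      Stable d h (seqOf q.1) s ∧ d s (h (seqOf q.1)) q.2 = true := by
    have hσ : Primrec fun q : (ℕ × ℕ) × ℕ => seqOf q.1.1 :=
      primrec_seqOf.comp (Primrec.fst.comp Primrec.fst)
    exact ((primrec_stable hd hh).comp hσ Primrec.snd).and (Primrec.eq.comp
      (hd.primrec.comp (Primrec.snd.pair ((hh.comp hσ).pair (Primrec.snd.comp Primrec.fst))))
      (Primrec.const true))
  have hψ : Partrec₂ fun e x : ℕ => Nat.rfind fun s => Part.some
      (decide (Stable d h (seqOf e) s ∧ d s (h (seqOf e)) x = true)) :=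
    Partrec.rfind (α := ℕ × ℕ) hP.decide.to_comp.partrec₂
  obtain ⟨t, ht, htψ⟩ := hφ.2 _ hψ
  refine ⟨fun σ => t (Encodable.encode σ), ht.comp Computable.encode, fun σ => ?_⟩
  ext x
  show (φ (t (Encodable.encode σ)) x).Dom ↔ _
  rw [htψ, seqOf_encode]
  refine Nat.rfind_dom.trans ?_
  constructor
  · rintro ⟨s, hs, -⟩
    exact ⟨s, by simpa using hs⟩
  · rintro ⟨s, hs⟩
    exact ⟨s, by simpa using hs, fun _ => trivial⟩

theorem exists_conservative_learner (hφ : IsAcceptable φ) (hh : Primrec h) {𝓛 : Set (Set ℕ)}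
    (hL : ∀ L ∈ 𝓛, ∀ T : Text, T.content = L → Ex φ (fun i => h (T.init i)) T)
    (hfin : ∀ L ∈ 𝓛, L.Finite → ∀ σ : DataSeq, σ.content ⊆ L → ¬ L ⊂ W φ (h σ)) :
    ∃ g : DataSeq →. ℕ, Partrec g ∧ ∀ L ∈ 𝓛, Learns (Conv φ ⊓ Ex φ) g L := by
  obtain ⟨d, hd⟩ := hφ.exists_isEnumeration
  obtain ⟨t, ht, htW⟩ := exists_index_stablePart hφ hd hh
  refine ⟨fun ρ => Part.some (t (candidate d h ρ)),
    (ht.comp (primrec_candidate hd hh).to_comp).partrec, fun L hLmem T hT => ?_⟩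
  refine ⟨fun i => t (candidate d h (T.init i)), fun i => Part.mem_some _, ?_, ?_⟩
  · intro i hi
    simp only [htW] at hi
    simp only [candidate_init_succ, revise_of_not_refuted (not_refuted hd hi)]
  · obtain ⟨n₀, hsub, hconst⟩ := candidate_converges hd (hL L hLmem) hT
    refine ⟨n₀, fun n hn => ⟨by simp only [hconst n hn], ?_⟩⟩
    simp only [htW, hT]
    by_contra hne
    exact not_ssubset_stablePart hd (hL L hLmem) (hfin L hLmem)
      ((content_candidate_subset T n₀).trans hT.subset) (hsub.ssubset_of_ne (Ne.symm hne))

/-! ### Comparison of the restrictions -/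

theorem cautTar_of_conv {p : ℕ → ℕ} {T : Text} (hc : Conv φ p T) (he : Ex φ p T) :
    CautTar φ p T := by
  intro i hi
  obtain ⟨n₀, hn₀⟩ := he
  have hconst : ∀ j ≥ i, p j = p i := by
    intro j hj
    induction j, hj using Nat.le_induction with
    | base => rfl
    | succ j _ ih =>
      rw [← ih]
      exact (hc j (ih ▸ (T.content_init_subset _).trans hi.subset)).symm
  have h₁ := hconst (max i n₀) (le_max_left _ _)
  have h₂ := hn₀ (max i n₀) (le_max_right _ _)
  rw [← h₁, h₂.1, h₂.2] at hi
  exact hi.ne rfl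

theorem cautFin_of_caut {p : ℕ → ℕ} {T : Text} (hc : Caut φ p T) : CautFin φ p T :=
  fun i j hij hss => absurd (hc j i hss) hij.not_gt

theorem cautTar_of_caut {p : ℕ → ℕ} {T : Text} (hc : Caut φ p T) (he : Ex φ p T) :
    CautTar φ p T := by
  intro i hi
  obtain ⟨n₀, hn₀⟩ := he
  have h₂ := hn₀ (max i n₀) (le_max_right _ _)
  rw [← h₂.2, ← h₂.1] at hi
  exact (hc _ _ hi).not_ge (le_max_left _ _)

theorem not_ssubset_of_cautFin {p : ℕ → ℕ} {T : Text} (hc : CautFin φ p T) (he : Ex φ p T)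
    (hfin : T.content.Finite) (i : ℕ) : ¬ T.content ⊂ W φ (p i) := by
  intro hi
  obtain ⟨n₀, hn₀⟩ := he
  have h₂ := hn₀ (max (i + 1) n₀) (le_max_right _ _)
  have hW : W φ (p (max (i + 1) n₀)) = T.content := by rw [h₂.1, h₂.2]
  exact hc i (max (i + 1) n₀) (by omega) (hW ▸ hi) (hW ▸ hfin)

/-- If a later delayed conjecture were a proper subset of an earlier one, the earlier would contain
all data seen up to the later; conservativeness then forces the two to coincide. -/
theorem mem_txtG_caut_of_conv (hφ : IsAcceptable φ) {𝓛 : Set (Set ℕ)}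
    (hmem : 𝓛 ∈ TxtG (Conv φ ⊓ Ex φ)) : 𝓛 ∈ TxtG (Caut φ ⊓ Ex φ) := by
  obtain ⟨hlang, h, hh, hL⟩ := hmem
  obtain ⟨h', hh', hspec⟩ := hφ.exists_consistent_learner hh
  refine ⟨hlang, fun ρ => Part.some (h' ρ), hh'.to_comp.partrec, fun L hLmem T hT => ?_⟩
  obtain ⟨p, hp, hconv, hex⟩ := hL L hLmem T hT
  obtain ⟨P, k, hempty, hP, hmono, hex'⟩ := hspec T p hp
  refine ⟨fun i => h' (T.init i), fun i => Part.mem_some _, ?_, hex' hex⟩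
  intro i j hss
  by_contra! hji
  simp only at hss
  by_cases hj : P j
  · obtain ⟨hi, hk⟩ := hmono j i hji hj
    rw [(hP i hi).1, (hP j hj).1] at hss
    have hconst : ∀ m ≥ k j, m ≤ k i → p m = p (k j) := by
      intro m hm hmi
      induction m, hm using Nat.le_induction with
      | base => rfl
      | succ m _ ih =>
        have ih := ih (by omega)
        rw [← ih]
        refine (hconv m ?_).symm
        rw [ih]
        exact (T.content_init_mono hmi).trans ((hP i hi).2.trans hss.subset)
    rw [hconst _ hk le_rfl] at hss
    exact hss.ne rfl
  · rw [hempty j hj] at hss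
    exact hss.not_subset (Set.empty_subset _)

/-- Isolates the only consequence of caution needed to construct a conservative learner. -/
theorem txtG_subset_conv (hφ : IsAcceptable φ) {δ : LearningRestriction}
    (hδ : ∀ p T, δ p T → Ex φ p T → T.content.Finite → ∀ i, ¬ T.content ⊂ W φ (p i)) :
    TxtG (δ ⊓ Ex φ) ⊆ TxtG (Conv φ ⊓ Ex φ) := by
  rintro 𝓛 ⟨hlang, h, hh, hL⟩
  obtain ⟨h', hh', hspec⟩ := hφ.exists_consistent_learner hh
  refine ⟨hlang, exists_conservative_learner hφ hh' (fun L hLmem T hT => ?_)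
    fun L hLmem hfin σ hσ => ?_⟩
  · obtain ⟨p, hp, -, hex⟩ := hL L hLmem T hT
    obtain ⟨-, -, -, -, -, hex'⟩ := hspec T p hp
    exact hex' hex
  · obtain ⟨T₀, hT₀⟩ := exists_text L
    -- Prefixing `σ` to a text for `L` makes `h' σ` an actual conjecture on such a text, so `hδ`
    -- applies.
    have hT : (Text.prepend σ T₀).content = L :=
      (Text.content_prepend (hT₀ ▸ hσ)).trans hT₀
    obtain ⟨p, hp, hδp, hex⟩ := hL L hLmem _ hT
    obtain ⟨P, k, hempty, hP, -, -⟩ := hspec _ p hp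
    rw [← Text.prepend_init σ T₀]
    by_cases hPσ : P σ.length
    · rw [(hP _ hPσ).1]
      have := hδ p _ hδp hex (hT ▸ hfin) (k σ.length)
      rwa [hT] at this
    · rw [hempty _ hPσ]
      exact fun hss => hss.not_subset (Set.empty_subset _)

theorem txtG_mono {δ δ' : LearningRestriction} (hδ : ∀ p T, δ p T → δ' p T) :
    TxtG δ ⊆ TxtG δ' := by
  rintro 𝓛 ⟨hlang, h, hh, hL⟩
  refine ⟨hlang, h, hh, fun L hLmem T hT => ?_⟩
  obtain ⟨p, hp, hδp⟩ := hL L hLmem T hT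
  exact ⟨p, hp, hδ p T hδp⟩

end LimitLearning

theorem mainTheorem1 (φ : ℕ → ℕ →. ℕ) (hφ : LimitLearning.IsAcceptable φ) :
    ∀ δ ∈ ({LimitLearning.Caut φ, LimitLearning.CautTar φ, LimitLearning.CautFin φ} :
        Set LimitLearning.LearningRestriction),
      LimitLearning.TxtG (δ ⊓ LimitLearning.Ex φ) =
        LimitLearning.TxtG (LimitLearning.Conv φ ⊓ LimitLearning.Ex φ) := by
  open LimitLearning in
  rintro δ (rfl | rfl | rfl)
  · exact (txtG_subset_conv hφ fun p T hc he _ => cautTar_of_caut hc he).antisymm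
      fun 𝓛 => mem_txtG_caut_of_conv hφ
  · exact (txtG_subset_conv hφ fun p T hc _ _ => hc).antisymm
      (txtG_mono fun p T hc => ⟨cautTar_of_conv hc.1 hc.2, hc.2⟩)
  · exact (txtG_subset_conv hφ fun p T hc he hfin => not_ssubset_of_cautFin hc he hfin).antisymm
      fun 𝓛 hmem => txtG_mono (fun p T hc => ⟨cautFin_of_caut hc.1, hc.2⟩)
        (mem_txtG_caut_of_conv hφ hmem)
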